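/- For real $q$ with $0<q\le 1$ let $\rho_G$ be the operator on $\mathbb C^3\otimes\mathbb C^3$ (Alice's system first, Bob's second, orthonormal basis $|0\rangle,|1\rangle,|2\rangle$ of $\mathbb C^3$) $$\rho_G=\tfrac19\Big[q\,|\psi^-\rangle\langle\psi^-|+(3-q)\,\tfrac{\mathbb I_2}{2}\otimes|2\rangle\langle2|+2q\,|2\rangle\langle2|\otimes\tfrac{\mathbb I_2}{2}+(6-2q)\,|22\rangle\langle22|\Big],$$ where $|\psi^-\rangle=(|01\rangle-|10\rangle)/\sqrt2$ and $\mathbb I_2=|0\rangle\langle0|+|1\rangle\langle1|$. A POVM is a finite family of positive semidefinite operators summing to the identity. A state $\rho$ is steerable from Alice to Bob if there are finitely many POVMs $\{M_{a|x}\}_a$ of Alice such that the operators $\sigma_{a|x}=\operatorname{tr}_A[(M_{a|x}\otimes\mathbb I)\rho]$ cannot be written as $\sigma_{a|x}=\int p_A(a|x,\lambda)\,\sigma_\lambda\,d\pi(\lambda)$ for all $a,x$, with a probability measure $\pi$, measurable response functions $p_A$ (for every $x$ and $\lambda$ a probability distribution in $a$) and density matrices $\sigma_\lambda$ depending measurably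 on $\lambda$; steerability from Bob to Alice is defined with the roles exchanged. A state $\rho$ is local for POVMs if it has a local hidden variable model for all POVMs: for every (possibly infinite) collections of POVMs $\{M_{a|x}\}_a$ of Alice and $\{N_{b|y}\}_b$ of Bob there are a probability measure $\pi$ and measurable response functions $p_A,p_B$ with $\operatorname{tr}[\rho\,(M_{a|x}\otimes N_{b|y})]=\int p_A(a|x,\lambda)\,p_B(b|y,\lambda)\,d\pi(\lambda)$ for all $a,b,x,y$. Then for every $0<q\le1$ the operator $\rho_G$ is a density matrix (positive semidefinite with trace $1$) that is steerable both from Alice to Bob and from Bob to Alice, and for every $0<q\le\tfrac12$ it is moreover local for POVMs. -/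

import Mathlib

open scoped Kronecker ComplexOrder
open MeasureTheory

noncomputable section

namespace QSteering

/-- A density matrix (quantum state): positive semidefinite with unit trace. -/
def IsDensityMatrix {n : Type} [Fintype n] (ρ : Matrix n n ℂ) : Prop :=
  ρ.PosSemidef ∧ ρ.trace = 1

/-- A POVM on `ℂⁿ` with finitely many outcomes `a : A`. -/
structure POVM (A n : Type) [Fintype A] [Fintype n] [DecidableEq n] where
  effect : A → Matrix n n ℂ
  posSemidef : ∀ a, (effect a).PosSemidef
  sum_eq_one : ∑ a, effect a = 1

/-- The partial trace over the first tensor factor. -/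
def trFst {m n : Type} [Fintype m] (R : Matrix (m × n) (m × n) ℂ) : Matrix n n ℂ :=
  Matrix.of fun j j' => ∑ i, R (i, j) (i, j')

/-- The partial trace over the second tensor factor. -/
def trSnd {m n : Type} [Fintype n] (R : Matrix (m × n) (m × n) ℂ) : Matrix m m ℂ :=
  Matrix.of fun i i' => ∑ j, R (i, j) (i', j)

/-- Local response functions `p(a|x,l)`: for every setting `x` and every value `l` of the hidden
variable a probability distribution on the outcomes of `x`, depending measurably on `l`. -/
structure IsResponse {X : Type} {A : X → Type} [∀ x, Fintype (A x)]
    {L : Type} [MeasurableSpace L] (p : ∀ x, A x → L → ℝ) : Prop where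
  measurable : ∀ x a, Measurable (p x a)
  nonneg : ∀ x a l, 0 ≤ p x a l
  sum_eq_one : ∀ x l, ∑ a, p x a l = 1

/-- Bell locality of a family of numbers `p(ab|xy)`:
`p(ab|xy) = ∫ p_A(a|x,l) p_B(b|y,l) dπ(l)` for a hidden variable `l` with law `π`. -/
def IsBellLocal {X Y : Type} {A : X → Type} {B : Y → Type}
    [∀ x, Fintype (A x)] [∀ y, Fintype (B y)]
    (p : ∀ x y, A x → B y → ℂ) : Prop :=
  ∃ (L : Type) (_ : MeasurableSpace L) (π : Measure L) (_ : IsProbabilityMeasure π)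
    (pA : ∀ x, A x → L → ℝ) (pB : ∀ y, B y → L → ℝ),
    IsResponse pA ∧ IsResponse pB ∧
      ∀ x y a b, p x y a b = ((∫ l, pA x a l * pB y b l ∂π : ℝ) : ℂ)

/-- The assemblage `σ_{a|x}` has a local hidden state decomposition:
`σ_{a|x} = ∫ p(a|x,l) σ_l dπ(l)` (entrywise) with density matrices `σ_l`. -/
def HasLHSDecomposition {X : Type} {A : X → Type} [∀ x, Fintype (A x)]
    {n : Type} [Fintype n] (σ : ∀ x, A x → Matrix n n ℂ) : Prop :=
  ∃ (L : Type) (_ : MeasurableSpace L) (π : Measure L) (_ : IsProbabilityMeasure π)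
    (p : ∀ x, A x → L → ℝ) (τ : L → Matrix n n ℂ),
    IsResponse p ∧ (∀ i j, Measurable fun l => τ l i j) ∧ (∀ l, IsDensityMatrix (τ l)) ∧
      ∀ x a i j, σ x a i j = ∫ l, (p x a l : ℂ) * τ l i j ∂π

variable {m n : Type} [Fintype m] [DecidableEq m] [Fintype n] [DecidableEq n]

/-- The state `ρ` is local for POVMs: for every (possibly infinite) collection of POVMs of Alice
and of Bob, the resulting statistics `tr (ρ (M_{a|x} ⊗ N_{b|y}))` are Bell local. The collections
may consist of all POVMs, and then one hidden variable serves all of them. -/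
def IsLocalForPOVMs (ρ : Matrix (m × n) (m × n) ℂ) : Prop :=
  ∀ (X Y : Type) (A : X → Type) (B : Y → Type) [∀ x, Fintype (A x)] [∀ y, Fintype (B y)]
    (M : ∀ x, POVM (A x) m) (N : ∀ y, POVM (B y) n),
    IsBellLocal fun x y a b => (ρ * ((M x).effect a ⊗ₖ (N y).effect b)).trace

/-- Alice can steer Bob: for some finite collection of POVMs of Alice, the assemblage
`tr_A ((M_{a|x} ⊗ 1) ρ)` prepared on Bob's side has no local hidden state decomposition. -/
def IsSteerableAliceToBob (ρ : Matrix (m × n) (m × n) ℂ) : Prop :=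
  ∃ (X : Type) (_ : Finite X) (A : X → Type) (_ : ∀ x, Fintype (A x)) (M : ∀ x, POVM (A x) m),
    ¬ HasLHSDecomposition fun x a => trFst (((M x).effect a ⊗ₖ (1 : Matrix n n ℂ)) * ρ)

/-- Bob can steer Alice: for some finite collection of POVMs of Bob, the assemblage
`tr_B ((1 ⊗ N_{b|y}) ρ)` prepared on Alice's side has no local hidden state decomposition. -/
def IsSteerableBobToAlice (ρ : Matrix (m × n) (m × n) ℂ) : Prop :=
  ∃ (Y : Type) (_ : Finite Y) (B : Y → Type) (_ : ∀ y, Fintype (B y)) (N : ∀ y, POVM (B y) n),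
    ¬ HasLHSDecomposition fun y b => trSnd (((1 : Matrix m m ℂ) ⊗ₖ (N y).effect b) * ρ)

/-- The vector `|ij⟩ = |i⟩ ⊗ |j⟩` of `ℂ³ ⊗ ℂ³`. -/
def ket (i j : Fin 3) : Fin 3 × Fin 3 → ℂ := Pi.single (i, j) 1

/-- The singlet vector `|ψ⁻⟩ = (|01⟩ - |10⟩) / √2`. -/
def singlet : Fin 3 × Fin 3 → ℂ := ((1 / Real.sqrt 2 : ℝ) : ℂ) • (ket 0 1 - ket 1 0)

/-- The operator `|ψ⁻⟩⟨ψ⁻|`. -/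
def singletProj : Matrix (Fin 3 × Fin 3) (Fin 3 × Fin 3) ℂ :=
  Matrix.vecMulVec singlet (star singlet)

/-- The operator `|i⟩⟨i|` on `ℂ³`. -/
def ketbra (i : Fin 3) : Matrix (Fin 3) (Fin 3) ℂ := Matrix.single i i 1

/-- The identity `𝕀₂` of the qubit subspace spanned by `|0⟩` and `|1⟩`, as an operator on `ℂ³`. -/
def qubitId : Matrix (Fin 3) (Fin 3) ℂ := ketbra 0 + ketbra 1

/-- The state `ρ_G = (1/9) [q |ψ⁻⟩⟨ψ⁻| + (3-q) (𝕀₂/2) ⊗ |2⟩⟨2| + 2q |2⟩⟨2| ⊗ (𝕀₂/2)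
+ (6-2q) |22⟩⟨22|]`. -/
def rhoG (q : ℝ) : Matrix (Fin 3 × Fin 3) (Fin 3 × Fin 3) ℂ :=
  (1 / 9 : ℂ) •
    ((q : ℂ) • singletProj
      + (3 - q : ℂ) • (((1 / 2 : ℂ) • qubitId) ⊗ₖ ketbra 2)
      + (2 * q : ℂ) • (ketbra 2 ⊗ₖ ((1 / 2 : ℂ) • qubitId))
      + (6 - 2 * q : ℂ) • (ketbra 2 ⊗ₖ ketbra 2))

end QSteering

end

/-!
**Steering.** The component of `ρ_G` on the two qubits is a singlet, so when Alice finds the qubit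
vector `u`, Bob's unnormalized state annihilates `u`. In a local hidden state model, almost every
hidden state that responds with the outcome `u_k` then annihilates `u_k`. A hidden state that does
so for two linearly independent qubit vectors has no weight on Bob's qubit, so each hidden state
contributes its qubit weight for at most one setting. Finding `u_k` leaves qubit weight `q / 18`,
while the total qubit weight is `q / 3` for Bob and `1 / 3` for Alice; hence more than `6`,
respectively `6 / q`, settings are contradictory.

**Locality.** `ρ_G` arises from the singlet with Bob's qubit erased with probability `1 - q` by
replacing each system with the flag `|2⟩` with probability `2 / 3`. Such a flagged state is local
for all POVMs as soon as the original one has a model for rank-one tests: write every effect as a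
sum of rank-one operators, give each outcome with a third of its acceptance probability (over all
outcomes these add up to at most the dimension `3`), and otherwise answer as the flag would. For
the erased singlet the hidden variable is a random direction `s` on the Bloch sphere; Alice answers
by the sign of `⟪x, s⟫` and Bob by the negative part of `⟪y, s⟫`, where `x` and `y` are the Bloch
vectors of the tests. The singlet correlations then come from the spherical averages
`∫ |⟪x, s⟫| = ‖x‖ / 2` and `‖x‖ ∫ sign ⟪x, s⟫ ⟪y, s⟫ = ⟪x, y⟫ / 2`, and `q ≤ 1 / 2` keeps Bob's
acceptance probabilities at most `1`.
-/

noncomputable section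

namespace QSteering

open Matrix Metric Set
open scoped RealInnerProductSpace

section UniformSphere

variable {E : Type*} [NormedAddCommGroup E] [InnerProductSpace ℝ E]

theorem abs_inner_sphere_le (v : E) (s : sphere (0 : E) 1) : |⟪v, s⟫| ≤ ‖v‖ := by
  simpa using abs_real_inner_le_norm v (s : E)

variable [FiniteDimensional ℝ E] [MeasurableSpace E] [BorelSpace E]

variable (E) in
/-- The uniform distribution on the unit sphere. -/
def sphereLaw : Measure (sphere (0 : E) 1) :=
  ((volume : Measure E).toSphere univ)⁻¹ • (volume : Measure E).toSphere

instance [Nontrivial E] : IsProbabilityMeasure (sphereLaw E) :=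
  have : NeZero (volume : Measure E).toSphere := ⟨Measure.toSphere_ne_zero _⟩
  isProbabilityMeasureSMul

theorem integrable_sphereLaw_of_abs_le {g : sphere (0 : E) 1 → ℝ} {C : ℝ} (hg : Measurable g)
    (hC : ∀ s, |g s| ≤ C) : Integrable g (sphereLaw E) := by
  nontriviality E
  exact .of_bound hg.aestronglyMeasurable C (.of_forall hC)

theorem integral_direction_mul_norm [Nontrivial E] (F : E → ℝ) (f : ℝ → ℝ) :
    ∫ x : E, F (‖x‖⁻¹ • x) * f ‖x‖ = (∫ s, F s ∂sphereLaw E) * ∫ x : E, f ‖x‖ := by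
  have polar (F : E → ℝ) : ∫ x : E, F (‖x‖⁻¹ • x) * f ‖x‖ =
      (∫ s, F s ∂(volume : Measure E).toSphere) *
        ∫ r : Ioi (0 : ℝ), f r ∂.volumeIoiPow (Module.finrank ℝ E - 1) := by
    rw [← integral_prod_mul (fun s : sphere (0 : E) 1 ↦ F s) fun r : Ioi (0 : ℝ) ↦ f r,
      ← (volume : Measure E).measurePreserving_homeomorphUnitSphereProd.integral_comp
        (Homeomorph.measurableEmbedding _), ← restrict_compl_singleton (μ := volume) (0 : E),
      ← integral_subtype_comap (measurableSet_singleton _).compl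
        fun x : E ↦ F (‖x‖⁻¹ • x) * f ‖x‖]
    simp
  have radial := polar fun _ ↦ 1
  have area_ne_zero : (volume : Measure E).toSphere.real univ ≠ 0 := by
    have : NeZero (volume : Measure E).toSphere := ⟨Measure.toSphere_ne_zero _⟩
    exact measureReal_univ_ne_zero
  simp only [one_mul, integral_const, smul_eq_mul, mul_one] at radial
  rw [radial, polar, sphereLaw, integral_smul_measure, ENNReal.toReal_inv, ← measureReal_def,
    smul_eq_mul]
  field_simp

theorem integral_sphereLaw_comp (R : E ≃ₗᵢ[ℝ] E) (g : E → ℝ) :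
    ∫ s, g (R s) ∂sphereLaw E = ∫ s, g s ∂sphereLaw E := by
  rcases subsingleton_or_nontrivial E with _ | _
  · exact congrArg _ (funext fun s ↦ congrArg g (Subsingleton.elim _ _))
  have gaussian_ne_zero : ∫ x : E, Real.exp (-‖x‖ ^ 2) ≠ 0 := by
    have := GaussianFourier.integral_rexp_neg_mul_sq_norm (V := E) one_pos
    simp only [neg_one_mul] at this
    rw [this]
    positivity
  have rotated := R.measurePreserving.integral_comp R.toHomeomorph.measurableEmbedding
    fun x ↦ g (‖x‖⁻¹ • x) * Real.exp (-‖x‖ ^ 2)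
  simp only [R.norm_map, ← map_smul] at rotated
  rw [integral_direction_mul_norm (fun x ↦ g (R x)) fun r ↦ Real.exp (-r ^ 2),
    integral_direction_mul_norm g fun r ↦ Real.exp (-r ^ 2)] at rotated
  exact mul_right_cancel₀ gaussian_ne_zero rotated

theorem integral_sphereLaw_eq_zero_of_odd {g : E → ℝ} (hg : ∀ x, g (-x) = -g x) :
    ∫ s, g s ∂sphereLaw E = 0 := by
  have := integral_sphereLaw_comp (LinearIsometryEquiv.neg ℝ) g
  simp only [LinearIsometryEquiv.coe_neg, hg, integral_neg] at this
  linarith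

theorem integrable_inner_sphere (v : E) :
    Integrable (fun s : sphere (0 : E) 1 ↦ ⟪v, s⟫) (sphereLaw E) :=
  integrable_sphereLaw_of_abs_le (by fun_prop) (abs_inner_sphere_le v)

theorem integral_mul_inner_eq_zero {u w : E} (huw : ⟪u, w⟫ = 0) (φ : ℝ → ℝ) :
    ∫ s : sphere (0 : E) 1, φ ⟪u, s⟫ * ⟪w, s⟫ ∂sphereLaw E = 0 := by
  let R := Submodule.reflection (ℝ ∙ w)ᗮ
  have inner_u (x : E) : ⟪u, R x⟫ = ⟪u, x⟫ := by
    have hRu : R u = u := Submodule.reflection_mem_subspace_eq_self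
      (Submodule.mem_orthogonal_singleton_iff_inner_left.2 huw)
    rw [← R.inner_map_map u x, hRu]
  have inner_w (x : E) : ⟪w, R x⟫ = -⟪w, x⟫ := by
    rw [← R.inner_map_map w x, Submodule.reflection_orthogonalComplement_singleton_eq_neg,
      inner_neg_left, neg_neg]
  have := integral_sphereLaw_comp R fun x ↦ φ ⟪u, x⟫ * ⟪w, x⟫
  simp only [inner_u, inner_w, mul_neg, integral_neg] at this
  linarith

theorem norm_sq_mul_integral_mul_inner {φ : ℝ → ℝ} (hφ : Measurable φ) {C : ℝ}
    (hC : ∀ t, |φ t| ≤ C) (u v : E) :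
    ‖u‖ ^ 2 * ∫ s : sphere (0 : E) 1, φ ⟪u, s⟫ * ⟪v, s⟫ ∂sphereLaw E =
      ⟪u, v⟫ * ∫ s : sphere (0 : E) 1, φ ⟪u, s⟫ * ⟪u, s⟫ ∂sphereLaw E := by
  have integrable (y : E) :
      Integrable (fun s : sphere (0 : E) 1 ↦ φ ⟪u, s⟫ * ⟪y, s⟫) (sphereLaw E) :=
    (integrable_inner_sphere y).bdd_mul (hφ.comp (by fun_prop)).aestronglyMeasurable
      (.of_forall fun s ↦ hC ⟪u, s⟫)
  have orthogonal : ⟪u, ‖u‖ ^ 2 • v - ⟪u, v⟫ • u⟫ = 0 := by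
    rw [inner_sub_right, inner_smul_right, inner_smul_right, real_inner_self_eq_norm_sq]
    ring
  have h := integral_mul_inner_eq_zero orthogonal φ
  simp only [inner_sub_left, real_inner_smul_left, mul_sub, mul_left_comm (φ _)] at h
  rwa [integral_sub ((integrable v).const_mul _) ((integrable u).const_mul _),
    integral_const_mul, integral_const_mul, sub_eq_zero] at h

end UniformSphere

section Gaussian

theorem integral_pow_mul_exp_neg_sq (n : ℕ) :
    ∫ y in Ioi (0 : ℝ), y ^ n * Real.exp (-y ^ 2) = 1 / 2 * Real.Gamma ((n + 1) / 2) := by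
  simpa using integral_rpow_mul_exp_neg_rpow (p := 2) (q := n) two_pos
    (neg_one_lt_zero.trans_le n.cast_nonneg)

theorem integral_abs_mul_exp_neg_sq : ∫ x : ℝ, |x| * Real.exp (-x ^ 2) = 1 := by
  have fold := integral_comp_abs (f := fun x ↦ x * Real.exp (-x ^ 2))
  have half := integral_pow_mul_exp_neg_sq 1
  norm_num at half
  simpa only [sq_abs, half, mul_one_div_cancel (two_ne_zero' ℝ)] using fold

theorem integral_prod_mul_exp_neg_norm_sq {ι : Type*} [Fintype ι] (g : ι → ℝ → ℝ) :
    ∫ x : EuclideanSpace ℝ ι, (∏ i, g i (x i)) * Real.exp (-‖x‖ ^ 2) =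
      ∏ i, ∫ t, g i t * Real.exp (-t ^ 2) := by
  rw [← integral_fintype_prod_volume_eq_prod fun i t ↦ g i t * Real.exp (-t ^ 2),
    ← (EuclideanSpace.volume_preserving_symm_measurableEquiv_toLp ι).integral_comp'
      (f := (MeasurableEquiv.toLp 2 (ι → ℝ)).symm)]
  congr 1 with x
  simp [EuclideanSpace.norm_sq_eq, Finset.prod_mul_distrib, ← Real.exp_sum]

/-- Real three-space, home of the Bloch vectors. -/
abbrev R3 : Type := EuclideanSpace ℝ (Fin 3)

theorem integral_abs_coord_mul_exp_neg_norm_sq :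
    ∫ x : R3, |x 2| * Real.exp (-‖x‖ ^ 2) = Real.pi := by
  have gaussian : ∫ t : ℝ, Real.exp (-t ^ 2) = √Real.pi := by simpa using integral_gaussian 1
  have product := integral_prod_mul_exp_neg_norm_sq fun (i : Fin 3) t ↦ if i = 2 then |t| else 1
  simpa [Fin.prod_univ_three, integral_abs_mul_exp_neg_sq, gaussian, Real.mul_self_sqrt,
    Real.pi_nonneg] using product

theorem integral_norm_mul_exp_neg_norm_sq :
    ∫ x : R3, ‖x‖ * Real.exp (-‖x‖ ^ 2) = 2 * Real.pi := by
  have radial := integral_fun_norm_addHaar (volume : Measure R3) fun r ↦ r * Real.exp (-r ^ 2)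
  have moment := integral_pow_mul_exp_neg_sq 3
  norm_num at moment
  have ball : (volume : Measure R3).real (ball 0 1) = 4 / 3 * Real.pi := by
    rw [measureReal_def, EuclideanSpace.volume_ball_fin_three, ENNReal.ofReal_one, one_pow,
      one_mul, ENNReal.toReal_ofReal (by positivity)]
    ring
  rw [radial, ball, finrank_euclideanSpace_fin]
  simp only [smul_eq_mul, nsmul_eq_mul, ← mul_assoc, ← pow_succ, Nat.reduceSub, Nat.reduceAdd,
    moment]
  norm_num
  ring

end Gaussian

section SphereIntegrals

theorem integral_abs_coord_sphereLaw : ∫ s, |(s : R3) 2| ∂sphereLaw R3 = 1 / 2 := by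
  have h := integral_direction_mul_norm (fun x : R3 ↦ |x 2|) fun r ↦ r * Real.exp (-r ^ 2)
  have cancel_norm (x : R3) :
      |(‖x‖⁻¹ • x) 2| * (‖x‖ * Real.exp (-‖x‖ ^ 2)) = |x 2| * Real.exp (-‖x‖ ^ 2) := by
    rcases eq_or_ne x 0 with rfl | hx
    · simp
    · have := norm_ne_zero_iff.2 hx
      simp only [PiLp.smul_apply, smul_eq_mul, abs_mul, abs_inv, abs_norm]
      field_simp
  simp only [cancel_norm, integral_abs_coord_mul_exp_neg_norm_sq,
    integral_norm_mul_exp_neg_norm_sq] at h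
  have := Real.pi_pos
  field_simp at h
  linarith

theorem integral_abs_inner_sphereLaw (v : R3) :
    ∫ s : sphere (0 : R3) 1, |⟪v, s⟫| ∂sphereLaw R3 = ‖v‖ / 2 := by
  let e : R3 := EuclideanSpace.single 2 1
  let R := Submodule.reflection (ℝ ∙ (‖v‖ • e - v))ᗮ
  have hR : R (‖v‖ • e) = v := Submodule.reflection_sub (by simp [e, norm_smul])
  have inner_R (x : R3) : ⟪v, R x⟫ = ‖v‖ * x 2 := by
    nth_rewrite 1 [← hR]
    rw [R.inner_map_map, real_inner_smul_left, EuclideanSpace.inner_single_left, map_one, one_mul]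
  rw [← integral_sphereLaw_comp R fun x ↦ |⟪v, x⟫|]
  simp only [inner_R, abs_mul, abs_norm, integral_const_mul, integral_abs_coord_sphereLaw]
  ring

theorem measurable_real_sign : Measurable Real.sign := by
  unfold Real.sign
  exact .ite measurableSet_Iio measurable_const
    (.ite measurableSet_Ioi measurable_const measurable_const)

theorem abs_real_sign_le_one (r : ℝ) : |Real.sign r| ≤ 1 := by
  rcases Real.sign_apply_eq r with h | h | h <;> simp [h]

theorem real_sign_mul_self (r : ℝ) : Real.sign r * r = |r| := by
  rcases lt_trichotomy r 0 with h | rfl | h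
  · rw [Real.sign_of_neg h, abs_of_neg h, neg_one_mul]
  · simp
  · rw [Real.sign_of_pos h, abs_of_pos h, one_mul]

theorem norm_mul_integral_sign_mul_inner (u v : R3) :
    ‖u‖ * ∫ s : sphere (0 : R3) 1, Real.sign ⟪u, s⟫ * ⟪v, s⟫ ∂sphereLaw R3 = ⟪u, v⟫ / 2 := by
  rcases eq_or_ne u 0 with rfl | hu
  · simp
  have h := norm_sq_mul_integral_mul_inner measurable_real_sign abs_real_sign_le_one u v
  simp only [real_sign_mul_self, integral_abs_inner_sphereLaw] at h
  refine mul_left_cancel₀ (norm_ne_zero_iff.2 hu) ?_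
  linear_combination h

end SphereIntegrals

section Response

variable {X L : Type} {A : X → Type} [∀ x, Fintype (A x)] [MeasurableSpace L]
  {p : ∀ x, A x → L → ℝ}

theorem IsResponse.le_one (hp : IsResponse p) (x : X) (a : A x) (l : L) : p x a l ≤ 1 :=
  hp.sum_eq_one x l ▸
    Finset.single_le_sum (f := fun a ↦ p x a l) (fun a _ ↦ hp.nonneg x a l) (Finset.mem_univ a)

theorem IsResponse.integrable (hp : IsResponse p) (π : Measure L) [IsFiniteMeasure π] (x : X)
    (a : A x) : Integrable (p x a) π :=
  .of_bound (hp.measurable x a).aestronglyMeasurable 1 <| .of_forall fun l ↦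
    (Real.norm_of_nonneg (hp.nonneg x a l)).trans_le (hp.le_one x a l)

end Response

section TensorProducts

variable {m n : Type} [Fintype m] [Fintype n]

theorem trace_trFst_mul [DecidableEq m] (R : Matrix (m × n) (m × n) ℂ) (N : Matrix n n ℂ) :
    (trFst R * N).trace = (R * ((1 : Matrix m m ℂ) ⊗ₖ N)).trace := by
  simp only [trace, diag_apply, mul_apply, trFst, of_apply, kroneckerMap_apply, one_apply,
    Fintype.sum_prod_type, Finset.sum_mul, ite_mul, one_mul, zero_mul, mul_ite, mul_zero,
    Finset.sum_ite_irrel, Finset.sum_const_zero, Finset.sum_ite_eq', Finset.mem_univ, if_true]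
  exact (Finset.sum_congr rfl fun j _ ↦ Finset.sum_comm).trans Finset.sum_comm

theorem trace_trSnd_mul [DecidableEq n] (R : Matrix (m × n) (m × n) ℂ) (M : Matrix m m ℂ) :
    (trSnd R * M).trace = (R * (M ⊗ₖ (1 : Matrix n n ℂ))).trace := by
  simp only [trace, diag_apply, mul_apply, trSnd, of_apply, kroneckerMap_apply, one_apply,
    Fintype.sum_prod_type, Finset.sum_mul, mul_ite, mul_one, mul_zero, Finset.sum_ite_eq',
    Finset.mem_univ, if_true]
  exact Finset.sum_congr rfl fun i _ ↦ Finset.sum_comm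

theorem trace_trFst_kronecker_mul [DecidableEq n] (ρ : Matrix (m × n) (m × n) ℂ)
    (M : Matrix m m ℂ) (N : Matrix n n ℂ) :
    (trFst ((M ⊗ₖ (1 : Matrix n n ℂ)) * ρ) * N).trace = (ρ * (M ⊗ₖ N)).trace := by
  classical
  rw [trace_trFst_mul, mul_assoc, trace_mul_comm, mul_assoc, ← mul_kronecker_mul, one_mul, mul_one]

theorem trace_trSnd_kronecker_mul [DecidableEq m] (ρ : Matrix (m × n) (m × n) ℂ)
    (M : Matrix m m ℂ) (N : Matrix n n ℂ) :
    (trSnd (((1 : Matrix m m ℂ) ⊗ₖ N) * ρ) * M).trace = (ρ * (M ⊗ₖ N)).trace := by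
  classical
  rw [trace_trSnd_mul, mul_assoc, trace_mul_comm, mul_assoc, ← mul_kronecker_mul, one_mul, mul_one]

theorem ext_trace_mul_kronecker {R S : Matrix (m × n) (m × n) ℂ}
    (h : ∀ M N, (R * (M ⊗ₖ N)).trace = (S * (M ⊗ₖ N)).trace) : R = S := by
  classical
  ext ⟨i, j⟩ ⟨i', j'⟩
  simpa [single_kronecker_single, trace_mul_single] using h (single i' i 1) (single j' j 1)

end TensorProducts

section PosSemidef

variable {n : Type} [Fintype n]

theorem trace_mul_vecMulVec_star (S : Matrix n n ℂ) (v : n → ℂ) :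
    (S * vecMulVec v (star v)).trace = star v ⬝ᵥ S *ᵥ v := by
  rw [mul_vecMulVec, trace_vecMulVec, dotProduct_comm]

theorem trace_mul_nonneg_of_posSemidef {S T : Matrix n n ℂ} (hS : S.PosSemidef)
    (hT : T.PosSemidef) : 0 ≤ (S * T).trace := by
  obtain ⟨r, v, rfl⟩ := posSemidef_iff_eq_sum_vecMulVec.1 hT
  simp only [Matrix.mul_sum, trace_sum, trace_mul_vecMulVec_star]
  exact Finset.sum_nonneg fun i _ ↦ hS.dotProduct_mulVec_nonneg (v i)

theorem ofReal_re_trace_mul_of_posSemidef {S T : Matrix n n ℂ} (hS : S.PosSemidef)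
    (hT : T.PosSemidef) : (((S * T).trace.re : ℝ) : ℂ) = (S * T).trace :=
  (Complex.eq_re_of_ofReal_le (trace_mul_nonneg_of_posSemidef hS hT)).symm

end PosSemidef

section Acceptance

variable {n L : Type} [Fintype n]

/-- The acceptance probability of the positive semidefinite operator `T` when a test of vectors is
applied to each vector of a (chosen) decomposition `T = ∑ᵢ vᵢvᵢ*`. -/
def acceptance (α : (n → ℂ) → L → ℝ) {T : Matrix n n ℂ} (hT : T.PosSemidef) (l : L) : ℝ :=
  ∑ i, α ((posSemidef_iff_eq_sum_vecMulVec.1 hT).choose_spec.choose i) l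

theorem exists_acceptance_eq_sum (α : (n → ℂ) → L → ℝ) {T : Matrix n n ℂ} (hT : T.PosSemidef) :
    ∃ (r : ℕ) (v : Fin r → n → ℂ), T = ∑ i, vecMulVec (v i) (star (v i)) ∧
      acceptance α hT = fun l ↦ ∑ i, α (v i) l :=
  ⟨_, _, (posSemidef_iff_eq_sum_vecMulVec.1 hT).choose_spec.choose_spec, rfl⟩

variable [MeasurableSpace L]

/-- Random answers to rank-one questions: for the value `l` of a hidden variable, the unnormalized
vector `w` is accepted with probability `α w l`, which is at most `‖w‖²`. -/
structure IsVectorTest (α : (n → ℂ) → L → ℝ) : Prop where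
  measurable : ∀ w, Measurable (α w)
  mem_Icc : ∀ w l, α w l ∈ Icc 0 (∑ i, Complex.normSq (w i))

variable {α : (n → ℂ) → L → ℝ} {T : Matrix n n ℂ}

namespace IsVectorTest

theorem measurable_acceptance (hα : IsVectorTest α) (hT : T.PosSemidef) :
    Measurable (acceptance α hT) :=
  Finset.measurable_fun_sum _ fun _ _ ↦ hα.measurable _

theorem acceptance_mem_Icc (hα : IsVectorTest α) (hT : T.PosSemidef) (l : L) :
    acceptance α hT l ∈ Icc 0 T.trace.re := by
  obtain ⟨r, v, hv, hacc⟩ := exists_acceptance_eq_sum α hT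
  have trace_eq : T.trace.re = ∑ i, ∑ j, Complex.normSq (v i j) := by
    simp [hv, trace_sum, trace_vecMulVec, dotProduct, Complex.mul_conj]
  rw [hacc, trace_eq]
  exact ⟨Finset.sum_nonneg fun i _ ↦ (hα.mem_Icc _ l).1,
    Finset.sum_le_sum fun i _ ↦ (hα.mem_Icc _ l).2⟩

theorem integrable_mul (hα : IsVectorTest α) {π : Measure L} {h : L → ℝ} (hh : Integrable h π)
    (w : n → ℂ) : Integrable (fun l ↦ α w l * h l) π :=
  hh.bdd_mul (hα.measurable w).aestronglyMeasurable <| .of_forall fun l ↦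
    (Real.norm_of_nonneg (hα.mem_Icc w l).1).trans_le (hα.mem_Icc w l).2

theorem integrable_acceptance_mul (hα : IsVectorTest α) (hT : T.PosSemidef) {π : Measure L}
    {h : L → ℝ} (hh : Integrable h π) : Integrable (fun l ↦ acceptance α hT l * h l) π := by
  simp only [acceptance, Finset.sum_mul]
  exact integrable_finsetSum _ fun i _ ↦ hα.integrable_mul hh _

theorem integral_acceptance_mul (hα : IsVectorTest α) (hT : T.PosSemidef) {π : Measure L}
    {h : L → ℝ} (hh : Integrable h π) {S : Matrix n n ℂ}
    (hS : ∀ w, ((∫ l, α w l * h l ∂π : ℝ) : ℂ) = (S * vecMulVec w (star w)).trace) :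
    ((∫ l, acceptance α hT l * h l ∂π : ℝ) : ℂ) = (S * T).trace := by
  obtain ⟨r, v, hv, hacc⟩ := exists_acceptance_eq_sum α hT
  simp only [hacc, Finset.sum_mul]
  rw [integral_finsetSum _ fun i _ ↦ hα.integrable_mul hh (v i), Complex.ofReal_sum, hv,
    Matrix.mul_sum, trace_sum]
  exact Finset.sum_congr rfl fun i _ ↦ hS (v i)

end IsVectorTest

end Acceptance

section FlaggedResponse

variable {n L A : Type} [Fintype n] [DecidableEq n] [Fintype A]

/-- The response to the POVM `M` which gives the answer accepted by a test of vectors with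
probability `1/d`, and otherwise (in particular if nothing is accepted) the answer that the state
`ξ` would give. -/
def flaggedResponse (α : (n → ℂ) → L → ℝ) (ξ : Matrix n n ℂ) (M : POVM A n) (a : A) (l : L) : ℝ :=
  (acceptance α (M.posSemidef a) l +
    (Fintype.card n - ∑ b, acceptance α (M.posSemidef b) l) * (ξ * M.effect a).trace.re) /
      Fintype.card n

theorem POVM.sum_trace_mul (M : POVM A n) (S : Matrix n n ℂ) :
    ∑ a, (S * M.effect a).trace = S.trace := by
  rw [← trace_sum, ← Matrix.mul_sum, M.sum_eq_one, mul_one]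

theorem IsDensityMatrix.card_ne_zero {n : Type} [Fintype n] {ξ : Matrix n n ℂ}
    (hξ : IsDensityMatrix ξ) : Fintype.card n ≠ 0 := fun h ↦ by
  have := Fintype.card_eq_zero_iff.1 h
  simpa [trace] using hξ.2

theorem IsDensityMatrix.sum_re_trace_mul_effect {ξ : Matrix n n ℂ} (hξ : IsDensityMatrix ξ)
    (M : POVM A n) : ∑ a, (ξ * M.effect a).trace.re = 1 := by
  rw [← Complex.re_sum, M.sum_trace_mul, hξ.2, Complex.one_re]

variable [MeasurableSpace L] {α : (n → ℂ) → L → ℝ} {ξ : Matrix n n ℂ}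

theorem IsVectorTest.sum_acceptance_le (hα : IsVectorTest α) (M : POVM A n) (l : L) :
    ∑ a, acceptance α (M.posSemidef a) l ≤ Fintype.card n := by
  have trace_sum_effect : ∑ a, (M.effect a).trace.re = Fintype.card n := by
    rw [← Complex.re_sum, ← trace_sum, M.sum_eq_one, trace_one, Complex.natCast_re]
  exact (Finset.sum_le_sum fun a _ ↦ (hα.acceptance_mem_Icc (M.posSemidef a) l).2).trans_eq
    trace_sum_effect

theorem IsVectorTest.isResponse_flaggedResponse (hα : IsVectorTest α) (hξ : IsDensityMatrix ξ)
    {X : Type} {A : X → Type} [∀ x, Fintype (A x)] (M : ∀ x, POVM (A x) n) :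
    IsResponse fun x ↦ flaggedResponse α ξ (M x) where
  measurable x a := by
    have (a : A x) := hα.measurable_acceptance ((M x).posSemidef a)
    unfold flaggedResponse
    fun_prop
  nonneg x a l := by
    have accepted := (hα.acceptance_mem_Icc ((M x).posSemidef a) l).1
    have rejected := sub_nonneg.2 (hα.sum_acceptance_le (M x) l)
    have default_nonneg := (Complex.nonneg_iff.1
      (trace_mul_nonneg_of_posSemidef hξ.1 ((M x).posSemidef a))).1
    unfold flaggedResponse
    positivity
  sum_eq_one x l := by
    have := Nat.cast_ne_zero (R := ℝ).2 hξ.card_ne_zero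
    simp only [flaggedResponse]
    rw [← Finset.sum_div, Finset.sum_add_distrib, ← Finset.mul_sum, hξ.sum_re_trace_mul_effect,
      mul_one, add_sub_cancel, div_self this]

theorem IsVectorTest.integral_flaggedResponse_mul (hα : IsVectorTest α) (hξ : IsDensityMatrix ξ)
    (M : POVM A n) (a : A) {π : Measure L} {h : L → ℝ} (hh : Integrable h π) {S : Matrix n n ℂ}
    (hS : ∀ w, ((∫ l, α w l * h l ∂π : ℝ) : ℂ) = (S * vecMulVec w (star w)).trace)
    (hS' : ((∫ l, h l ∂π : ℝ) : ℂ) = S.trace) :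
    ((∫ l, flaggedResponse α ξ M a l * h l ∂π : ℝ) : ℂ) =
      ((S * M.effect a).trace +
        (Fintype.card n - 1) * S.trace * (ξ * M.effect a).trace) / Fintype.card n := by
  have integrable (b : A) := hα.integrable_acceptance_mul (M.posSemidef b) hh
  have expand (l : L) : flaggedResponse α ξ M a l * h l =
      (acceptance α (M.posSemidef a) l * h l +
        (Fintype.card n * h l - ∑ b, acceptance α (M.posSemidef b) l * h l) *
          (ξ * M.effect a).trace.re) / Fintype.card n := by
    rw [flaggedResponse, ← Finset.sum_mul]
    ring
  have integrable_rejected : Integrable (fun l ↦ Fintype.card n * h l -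
      ∑ b, acceptance α (M.posSemidef b) l * h l) π :=
    (hh.const_mul _).sub (integrable_finsetSum _ fun b _ ↦ integrable b)
  simp only [expand]
  rw [integral_div, integral_add (integrable a) (integrable_rejected.mul_const _),
    integral_mul_const,
    integral_sub (hh.const_mul _) (integrable_finsetSum _ fun b _ ↦ integrable b),
    integral_const_mul, integral_finsetSum _ fun b _ ↦ integrable b]
  push_cast
  simp only [hα.integral_acceptance_mul _ hh hS, hS', M.sum_trace_mul,
    ofReal_re_trace_mul_of_posSemidef hξ.1 (M.posSemidef a)]
  ring

end FlaggedResponse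

section Flagging

variable {m n : Type} [Fintype m] [Fintype n]

/-- The state obtained from `ρ` when the first party keeps it with probability `1/d`, where `d` is
the dimension of her system, and otherwise replaces her part by the state `ξ`. -/
def flagFst (ξ : Matrix m m ℂ) (ρ : Matrix (m × n) (m × n) ℂ) : Matrix (m × n) (m × n) ℂ :=
  (Fintype.card m : ℂ)⁻¹ • (ρ + (Fintype.card m - 1 : ℂ) • ξ ⊗ₖ trFst ρ)

/-- The state obtained from `ρ` when the second party keeps it with probability `1/d`, where `d` is
the dimension of his system, and otherwise replaces his part by the state `η`. -/
def flagSnd (η : Matrix n n ℂ) (ρ : Matrix (m × n) (m × n) ℂ) : Matrix (m × n) (m × n) ℂ :=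
  (Fintype.card n : ℂ)⁻¹ • (ρ + (Fintype.card n - 1 : ℂ) • trSnd ρ ⊗ₖ η)

theorem trace_flagFst_mul_kronecker [DecidableEq m] (ξ : Matrix m m ℂ)
    (ρ : Matrix (m × n) (m × n) ℂ) (M : Matrix m m ℂ) (N : Matrix n n ℂ) :
    (flagFst ξ ρ * (M ⊗ₖ N)).trace = ((ρ * (M ⊗ₖ N)).trace +
      (Fintype.card m - 1) * (ρ * ((1 : Matrix m m ℂ) ⊗ₖ N)).trace * (ξ * M).trace) /
        Fintype.card m := by
  rw [flagFst, smul_mul, trace_smul, add_mul, trace_add, smul_mul, trace_smul,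
    ← mul_kronecker_mul, trace_kronecker, trace_trFst_mul, smul_eq_mul, smul_eq_mul]
  ring

theorem trace_flagSnd_mul_kronecker [DecidableEq n] (η : Matrix n n ℂ)
    (ρ : Matrix (m × n) (m × n) ℂ) (M : Matrix m m ℂ) (N : Matrix n n ℂ) :
    (flagSnd η ρ * (M ⊗ₖ N)).trace = ((ρ * (M ⊗ₖ N)).trace +
      (Fintype.card n - 1) * (ρ * (M ⊗ₖ (1 : Matrix n n ℂ))).trace * (η * N).trace) /
        Fintype.card n := by
  rw [flagSnd, smul_mul, trace_smul, add_mul, trace_add, smul_mul, trace_smul,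
    ← mul_kronecker_mul, trace_kronecker, trace_trSnd_mul, smul_eq_mul, smul_eq_mul]
  ring

variable {L : Type} [MeasurableSpace L] {π : Measure L}
  {A B : Type} [Fintype A] [Fintype B] {h : L → ℝ}

theorem IsVectorTest.integral_flaggedResponse_mul_eq_flagFst [DecidableEq m] {α : (m → ℂ) → L → ℝ}
    (hα : IsVectorTest α) {ξ : Matrix m m ℂ} (hξ : IsDensityMatrix ξ) (M : POVM A m) (a : A)
    (hh : Integrable h π) {ρ : Matrix (m × n) (m × n) ℂ} {N : Matrix n n ℂ}
    (hρ : ∀ w, ((∫ l, α w l * h l ∂π : ℝ) : ℂ) = (ρ * (vecMulVec w (star w) ⊗ₖ N)).trace)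
    (hρ' : ((∫ l, h l ∂π : ℝ) : ℂ) = (ρ * ((1 : Matrix m m ℂ) ⊗ₖ N)).trace) :
    ((∫ l, flaggedResponse α ξ M a l * h l ∂π : ℝ) : ℂ) =
      (flagFst ξ ρ * (M.effect a ⊗ₖ N)).trace := by
  have trace_eq (T : Matrix m m ℂ) := trace_trSnd_kronecker_mul ρ T N
  have trace_eq_one := trace_eq 1
  rw [mul_one] at trace_eq_one
  rw [hα.integral_flaggedResponse_mul hξ M a hh (fun w ↦ (hρ w).trans (trace_eq _).symm)
    (hρ'.trans trace_eq_one.symm), trace_flagFst_mul_kronecker, trace_eq, trace_eq_one]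

theorem IsVectorTest.integral_flaggedResponse_mul_eq_flagSnd [DecidableEq n] {β : (n → ℂ) → L → ℝ}
    (hβ : IsVectorTest β) {η : Matrix n n ℂ} (hη : IsDensityMatrix η) (N : POVM B n) (b : B)
    (hh : Integrable h π) {ρ : Matrix (m × n) (m × n) ℂ} {M : Matrix m m ℂ}
    (hρ : ∀ v, ((∫ l, β v l * h l ∂π : ℝ) : ℂ) = (ρ * (M ⊗ₖ vecMulVec v (star v))).trace)
    (hρ' : ((∫ l, h l ∂π : ℝ) : ℂ) = (ρ * (M ⊗ₖ (1 : Matrix n n ℂ))).trace) :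
    ((∫ l, flaggedResponse β η N b l * h l ∂π : ℝ) : ℂ) =
      (flagSnd η ρ * (M ⊗ₖ N.effect b)).trace := by
  have trace_eq (T : Matrix n n ℂ) := trace_trFst_kronecker_mul ρ M T
  have trace_eq_one := trace_eq 1
  rw [mul_one] at trace_eq_one
  rw [hβ.integral_flaggedResponse_mul hη N b hh (fun v ↦ (hρ v).trans (trace_eq _).symm)
    (hρ'.trans trace_eq_one.symm), trace_flagSnd_mul_kronecker, trace_eq, trace_eq_one]

variable [DecidableEq m] [DecidableEq n]

/-- A hidden variable model of `ρ` restricted to rank-one operators: the unnormalized vectors `w`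
of the first and `v` of the second party are accepted with probabilities `α w l` and `β v l`,
where `l` has law `π`. -/
structure IsVectorModel (ρ : Matrix (m × n) (m × n) ℂ) (π : Measure L)
    (α : (m → ℂ) → L → ℝ) (β : (n → ℂ) → L → ℝ) : Prop where
  test_fst : IsVectorTest α
  test_snd : IsVectorTest β
  trace_eq_one : ρ.trace = 1
  integral_fst : ∀ w, ((∫ l, α w l ∂π : ℝ) : ℂ) =
    (ρ * (vecMulVec w (star w) ⊗ₖ (1 : Matrix n n ℂ))).trace
  integral_snd : ∀ v, ((∫ l, β v l ∂π : ℝ) : ℂ) =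
    (ρ * ((1 : Matrix m m ℂ) ⊗ₖ vecMulVec v (star v))).trace
  integral_mul : ∀ w v, ((∫ l, α w l * β v l ∂π : ℝ) : ℂ) =
    (ρ * (vecMulVec w (star w) ⊗ₖ vecMulVec v (star v))).trace

theorem IsVectorModel.isLocalForPOVMs_flag [IsProbabilityMeasure π]
    {ρ : Matrix (m × n) (m × n) ℂ} {α : (m → ℂ) → L → ℝ} {β : (n → ℂ) → L → ℝ}
    (hρ : IsVectorModel ρ π α β) {ξ : Matrix m m ℂ} (hξ : IsDensityMatrix ξ) {η : Matrix n n ℂ}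
    (hη : IsDensityMatrix η) : IsLocalForPOVMs (flagSnd η (flagFst ξ ρ)) := by
  intro X Y A B _ _ M N
  have response_fst := hρ.test_fst.isResponse_flaggedResponse hξ M
  have response_snd := hρ.test_snd.isResponse_flaggedResponse hη N
  refine ⟨L, inferInstance, π, inferInstance, _, _, response_fst, response_snd, fun x y a b ↦ ?_⟩
  let pA := flaggedResponse α ξ (M x) a
  have integral_pA : ((∫ l, pA l ∂π : ℝ) : ℂ) =
      (flagFst ξ ρ * ((M x).effect a ⊗ₖ (1 : Matrix n n ℂ))).trace := by
    simpa only [mul_one] using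
      hρ.test_fst.integral_flaggedResponse_mul_eq_flagFst hξ (M x) a (integrable_const (1 : ℝ))
        (ρ := ρ) (N := 1) (by simpa only [mul_one] using hρ.integral_fst)
        (by simp [hρ.trace_eq_one])
  have integral_pA_mul (v : n → ℂ) : ((∫ l, β v l * pA l ∂π : ℝ) : ℂ) =
      (flagFst ξ ρ * ((M x).effect a ⊗ₖ vecMulVec v (star v))).trace := by
    have integrable_snd : Integrable (β v) π := by
      simpa only [mul_one] using hρ.test_snd.integrable_mul (integrable_const (1 : ℝ)) v
    simpa only [mul_comm] using
      hρ.test_fst.integral_flaggedResponse_mul_eq_flagFst hξ (M x) a integrable_snd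
        (fun w ↦ hρ.integral_mul w v) (hρ.integral_snd v)
  have integrable_pA : Integrable pA π := response_fst.integrable π x a
  simpa only [mul_comm] using (hρ.test_snd.integral_flaggedResponse_mul_eq_flagSnd hη (N y) b
    integrable_pA integral_pA_mul integral_pA).symm

end Flagging

section TraceFormulas

theorem trace_singletProj_mul_kronecker (M N : Matrix (Fin 3) (Fin 3) ℂ) :
    (singletProj * (M ⊗ₖ N)).trace =
      (M 0 0 * N 1 1 - M 0 1 * N 1 0 - M 1 0 * N 0 1 + M 1 1 * N 0 0) / 2 := by
  have amplitude_sq : ((1 / √2 : ℝ) : ℂ) * ((1 / √2 : ℝ) : ℂ) = 1 / 2 := by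
    rw [← Complex.ofReal_mul, div_mul_div_comm, Real.mul_self_sqrt zero_le_two]
    norm_num
  rw [singletProj, vecMulVec_mul, trace_vecMulVec]
  simp only [singlet, ket, star_smul, smul_vecMul, dotProduct_smul, smul_dotProduct, smul_eq_mul,
    ← mul_assoc, Complex.star_def, Complex.conj_ofReal, amplitude_sq]
  simp [sub_vecMul, sub_dotProduct, dotProduct_sub]
  ring

theorem trace_ketbra_mul (i : Fin 3) (M : Matrix (Fin 3) (Fin 3) ℂ) :
    (ketbra i * M).trace = M i i := by
  simp [ketbra, trace_single_mul]

theorem trace_rhoG_mul_kronecker (q : ℝ) (M N : Matrix (Fin 3) (Fin 3) ℂ) :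
    (rhoG q * (M ⊗ₖ N)).trace =
      (q * (M 0 0 * N 1 1 - M 0 1 * N 1 0 - M 1 0 * N 0 1 + M 1 1 * N 0 0) / 2
        + (3 - q) * (M 0 0 + M 1 1) * N 2 2 / 2 + q * M 2 2 * (N 0 0 + N 1 1)
        + (6 - 2 * q) * M 2 2 * N 2 2) / 9 := by
  simp only [rhoG, add_mul, smul_mul, trace_add, trace_smul, trace_singletProj_mul_kronecker,
    ← mul_kronecker_mul, trace_kronecker, qubitId, trace_ketbra_mul, smul_eq_mul]
  ring

theorem trace_rhoG (q : ℝ) : (rhoG q).trace = 1 := by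
  have h := trace_rhoG_mul_kronecker q 1 1
  rw [one_kronecker_one, mul_one] at h
  rw [h]
  simp
  ring

theorem posSemidef_ketbra (i : Fin 3) : (ketbra i).PosSemidef := by
  have h := posSemidef_vecMulVec_self_star (Pi.single i 1 : Fin 3 → ℂ)
  rwa [← Pi.single_star, star_one, ← single_eq_single_vecMulVec_single] at h

theorem isDensityMatrix_ketbra (i : Fin 3) : IsDensityMatrix (ketbra i) :=
  ⟨posSemidef_ketbra i, by simp [ketbra]⟩

theorem posSemidef_qubitId : qubitId.PosSemidef :=
  (posSemidef_ketbra 0).add (posSemidef_ketbra 1)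

theorem isDensityMatrix_rhoG {q : ℝ} (hq : 0 ≤ q) (hq3 : q ≤ 3) : IsDensityMatrix (rhoG q) := by
  have half_qubitId : ((1 / 2 : ℂ) • qubitId).PosSemidef := posSemidef_qubitId.smul (by simp)
  have q_nonneg : (0 : ℂ) ≤ q := by exact_mod_cast hq
  have le_three : (q : ℂ) ≤ 3 := by exact_mod_cast hq3
  have two_mul_le : (2 * q : ℂ) ≤ 6 := by exact_mod_cast (by linarith : 2 * q ≤ 6)
  refine ⟨.smul (((PosSemidef.add ?_ ?_).add ?_).add ?_) (by simp), trace_rhoG q⟩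
  · exact (posSemidef_vecMulVec_self_star _).smul q_nonneg
  · exact (half_qubitId.kronecker (posSemidef_ketbra 2)).smul (sub_nonneg.2 le_three)
  · exact ((posSemidef_ketbra 2).kronecker half_qubitId).smul (mul_nonneg zero_le_two q_nonneg)
  · exact ((posSemidef_ketbra 2).kronecker (posSemidef_ketbra 2)).smul (sub_nonneg.2 two_mul_le)

/-- The singlet after Bob's qubit has been erased, that is replaced by the flag `|2⟩`, with
probability `1 - q`. -/
def erasedSinglet (q : ℝ) : Matrix (Fin 3 × Fin 3) (Fin 3 × Fin 3) ℂ :=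
  (q : ℂ) • singletProj + (1 - q : ℂ) • (((1 / 2 : ℂ) • qubitId) ⊗ₖ ketbra 2)

theorem trace_erasedSinglet_mul_kronecker (q : ℝ) (M N : Matrix (Fin 3) (Fin 3) ℂ) :
    (erasedSinglet q * (M ⊗ₖ N)).trace =
      q * (M 0 0 * N 1 1 - M 0 1 * N 1 0 - M 1 0 * N 0 1 + M 1 1 * N 0 0) / 2
        + (1 - q) * (M 0 0 + M 1 1) * N 2 2 / 2 := by
  simp only [erasedSinglet, add_mul, smul_mul, trace_add, trace_smul,
    trace_singletProj_mul_kronecker, ← mul_kronecker_mul, trace_kronecker, qubitId,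
    trace_ketbra_mul, smul_eq_mul]
  ring

theorem trace_erasedSinglet (q : ℝ) : (erasedSinglet q).trace = 1 := by
  have h := trace_erasedSinglet_mul_kronecker q 1 1
  rw [one_kronecker_one, mul_one] at h
  rw [h]
  simp
  ring

theorem rhoG_eq_flag_erasedSinglet (q : ℝ) :
    rhoG q = flagSnd (ketbra 2) (flagFst (ketbra 2) (erasedSinglet q)) := by
  refine ext_trace_mul_kronecker fun M N ↦ ?_
  simp only [trace_rhoG_mul_kronecker, trace_flagSnd_mul_kronecker, trace_flagFst_mul_kronecker,
    trace_erasedSinglet_mul_kronecker, trace_ketbra_mul, Fintype.card_fin]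
  simp
  ring

end TraceFormulas

section ErasedSinglet

/-- The squared norm of the component of `w` in the qubit subspace. -/
def qubitWeight (w : Fin 3 → ℂ) : ℝ := Complex.normSq (w 0) + Complex.normSq (w 1)

/-- The Bloch vector of the component of `w` in the qubit subspace; it has length
`qubitWeight w`. -/
def blochVec (w : Fin 3 → ℂ) : R3 :=
  !₂[2 * (w 0 * star (w 1)).re, 2 * (w 0 * star (w 1)).im,
    Complex.normSq (w 0) - Complex.normSq (w 1)]

theorem qubitWeight_nonneg (w : Fin 3 → ℂ) : 0 ≤ qubitWeight w :=
  add_nonneg (Complex.normSq_nonneg _) (Complex.normSq_nonneg _)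

theorem norm_blochVec (w : Fin 3 → ℂ) : ‖blochVec w‖ = qubitWeight w := by
  rw [EuclideanSpace.norm_eq, Real.sqrt_eq_iff_mul_self_eq (by positivity) (qubitWeight_nonneg w)]
  simp [Fin.sum_univ_three, blochVec, qubitWeight, Complex.normSq_apply]
  ring

theorem sum_normSq_eq (w : Fin 3 → ℂ) :
    ∑ i, Complex.normSq (w i) = qubitWeight w + Complex.normSq (w 2) :=
  Fin.sum_univ_three _

/-- Alice's probability of accepting the unnormalized vector `w`, for the hidden direction `s`. -/
def aliceTest (w : Fin 3 → ℂ) (s : sphere (0 : R3) 1) : ℝ :=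
  qubitWeight w * (1 + Real.sign ⟪blochVec w, s⟫) / 2

/-- Bob's probability of accepting the unnormalized vector `v`, for the hidden direction `s`. -/
def bobTest (q : ℝ) (v : Fin 3 → ℂ) (s : sphere (0 : R3) 1) : ℝ :=
  q * (|⟪blochVec v, s⟫| - ⟪blochVec v, s⟫) + (1 - q) * Complex.normSq (v 2)

theorem isVectorTest_aliceTest : IsVectorTest aliceTest where
  measurable w := by
    have := measurable_real_sign
    unfold aliceTest
    fun_prop
  mem_Icc w s := by
    obtain ⟨lower, upper⟩ := abs_le.1 (abs_real_sign_le_one ⟪blochVec w, s⟫)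
    have := qubitWeight_nonneg w
    have := Complex.normSq_nonneg (w 2)
    rw [sum_normSq_eq, aliceTest]
    constructor <;> nlinarith

theorem isVectorTest_bobTest {q : ℝ} (hq : 0 ≤ q) (hq2 : q ≤ 1 / 2) :
    IsVectorTest (bobTest q) where
  measurable v := by
    unfold bobTest
    fun_prop
  mem_Icc v s := by
    have le_norm := abs_inner_sphere_le (blochVec v) s
    rw [norm_blochVec] at le_norm
    have := le_abs_self ⟪blochVec v, (s : R3)⟫
    have := neg_le_abs ⟪blochVec v, (s : R3)⟫
    have := Complex.normSq_nonneg (v 2)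
    rw [sum_normSq_eq, bobTest]
    constructor <;> nlinarith

theorem integral_real_sign_inner (u : R3) :
    ∫ s : sphere (0 : R3) 1, Real.sign ⟪u, s⟫ ∂sphereLaw R3 = 0 :=
  integral_sphereLaw_eq_zero_of_odd (g := fun x ↦ Real.sign ⟪u, x⟫) fun x ↦ by
    rw [inner_neg_right, Real.sign_neg]

theorem integrable_real_sign_inner_mul (u : R3) {f : sphere (0 : R3) 1 → ℝ}
    (hf : Integrable f (sphereLaw R3)) :
    Integrable (fun s : sphere (0 : R3) 1 ↦ Real.sign ⟪u, s⟫ * f s) (sphereLaw R3) :=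
  hf.bdd_mul (measurable_real_sign.comp (by fun_prop)).aestronglyMeasurable
    (.of_forall fun s ↦ abs_real_sign_le_one ⟪u, s⟫)

theorem integrable_real_sign_inner (u : R3) :
    Integrable (fun s : sphere (0 : R3) 1 ↦ Real.sign ⟪u, s⟫) (sphereLaw R3) := by
  simpa only [mul_one] using integrable_real_sign_inner_mul u (integrable_const (1 : ℝ))

theorem integral_aliceTest (w : Fin 3 → ℂ) :
    ∫ s, aliceTest w s ∂sphereLaw R3 = qubitWeight w / 2 := by
  unfold aliceTest
  rw [integral_div, integral_const_mul,
    integral_add (integrable_const _) (integrable_real_sign_inner _), integral_real_sign_inner]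
  simp

theorem integrable_bobTest (q : ℝ) (v : Fin 3 → ℂ) : Integrable (bobTest q v) (sphereLaw R3) := by
  have integrable_inner := integrable_inner_sphere (blochVec v)
  exact ((integrable_inner.abs.sub integrable_inner).const_mul q).add (integrable_const _)

theorem integral_bobTest (q : ℝ) (v : Fin 3 → ℂ) :
    ∫ s, bobTest q v s ∂sphereLaw R3 = q * qubitWeight v / 2 + (1 - q) * Complex.normSq (v 2) := by
  have integrable_inner := integrable_inner_sphere (blochVec v)
  have integral_inner : ∫ s : sphere (0 : R3) 1, ⟪blochVec v, s⟫ ∂sphereLaw R3 = 0 :=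
    integral_sphereLaw_eq_zero_of_odd (g := fun x ↦ ⟪blochVec v, x⟫) (inner_neg_right _)
  have integrable_abs_sub : Integrable (fun s : sphere (0 : R3) 1 ↦
      |⟪blochVec v, s⟫| - ⟪blochVec v, s⟫) (sphereLaw R3) :=
    integrable_inner.abs.sub integrable_inner
  unfold bobTest
  rw [integral_add (integrable_abs_sub.const_mul q) (integrable_const _),
    integral_const_mul, integral_sub integrable_inner.abs integrable_inner, integral_inner,
    integral_abs_inner_sphereLaw, norm_blochVec]
  simp
  ring

theorem qubitWeight_mul_integral_sign_mul_bobTest (q : ℝ) (w v : Fin 3 → ℂ) :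
    qubitWeight w * ∫ s, Real.sign ⟪blochVec w, s⟫ * bobTest q v s ∂sphereLaw R3 =
      -(q * ⟪blochVec w, blochVec v⟫ / 2) := by
  let odd (x : R3) : ℝ :=
    Real.sign ⟪blochVec w, x⟫ * (q * |⟪blochVec v, x⟫| + (1 - q) * Complex.normSq (v 2))
  have integral_odd : ∫ s, odd s ∂sphereLaw R3 = 0 :=
    integral_sphereLaw_eq_zero_of_odd fun x ↦ by
      simp only [odd, inner_neg_right, Real.sign_neg, abs_neg, neg_mul]
  have split (s : sphere (0 : R3) 1) : Real.sign ⟪blochVec w, s⟫ * bobTest q v s =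
      odd s - q * (Real.sign ⟪blochVec w, s⟫ * ⟪blochVec v, s⟫) := by
    simp only [bobTest, odd]
    ring
  have integrable_inner := integrable_inner_sphere (blochVec v)
  have integrable_odd : Integrable (fun s : sphere (0 : R3) 1 ↦ odd s) (sphereLaw R3) :=
    integrable_real_sign_inner_mul _ ((integrable_inner.abs.const_mul q).add (integrable_const _))
  simp only [split]
  rw [integral_sub integrable_odd ((integrable_real_sign_inner_mul _ integrable_inner).const_mul q),
    integral_odd, integral_const_mul, zero_sub, mul_neg, mul_left_comm, ← norm_blochVec,
    norm_mul_integral_sign_mul_inner, mul_div_assoc]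

theorem integral_aliceTest_mul_bobTest (q : ℝ) (w v : Fin 3 → ℂ) :
    ∫ s, aliceTest w s * bobTest q v s ∂sphereLaw R3 =
      q * (qubitWeight w * qubitWeight v - ⟪blochVec w, blochVec v⟫) / 4
        + (1 - q) * qubitWeight w * Complex.normSq (v 2) / 2 := by
  have expand (s : sphere (0 : R3) 1) : aliceTest w s * bobTest q v s =
      qubitWeight w / 2 * (bobTest q v s + Real.sign ⟪blochVec w, s⟫ * bobTest q v s) := by
    rw [aliceTest]
    ring
  simp only [expand]
  rw [integral_const_mul, integral_add (integrable_bobTest q v)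
    (integrable_real_sign_inner_mul _ (integrable_bobTest q v)), integral_bobTest]
  linear_combination qubitWeight_mul_integral_sign_mul_bobTest q w v / 2

theorem isVectorModel_erasedSinglet {q : ℝ} (hq : 0 ≤ q) (hq2 : q ≤ 1 / 2) :
    IsVectorModel (erasedSinglet q) (sphereLaw R3) aliceTest (bobTest q) where
  test_fst := isVectorTest_aliceTest
  test_snd := isVectorTest_bobTest hq hq2
  trace_eq_one := trace_erasedSinglet q
  integral_fst w := by
    rw [integral_aliceTest, trace_erasedSinglet_mul_kronecker]
    simp [vecMulVec_apply, qubitWeight, Complex.mul_conj]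
    ring
  integral_snd v := by
    rw [integral_bobTest, trace_erasedSinglet_mul_kronecker]
    simp [vecMulVec_apply, qubitWeight, Complex.mul_conj]
    ring
  integral_mul w v := by
    rw [integral_aliceTest_mul_bobTest, trace_erasedSinglet_mul_kronecker]
    apply Complex.ext <;>
      simp [vecMulVec_apply, qubitWeight, blochVec, Complex.normSq_apply, PiLp.inner_apply,
        Fin.sum_univ_three] <;>
      ring

theorem isLocalForPOVMs_rhoG {q : ℝ} (hq : 0 ≤ q) (hq2 : q ≤ 1 / 2) :
    IsLocalForPOVMs (rhoG q) := by
  rw [rhoG_eq_flag_erasedSinglet]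
  exact (isVectorModel_erasedSinglet hq hq2).isLocalForPOVMs_flag (isDensityMatrix_ketbra 2)
    (isDensityMatrix_ketbra 2)

end ErasedSinglet

section LocalHiddenStates

theorem IsDensityMatrix.norm_apply_le_one {n : Type} [Fintype n] {ρ : Matrix n n ℂ}
    (hρ : IsDensityMatrix ρ) (i j : n) : ‖ρ i j‖ ≤ 1 := by
  have diag_nonneg (k : n) : 0 ≤ ρ k k := hρ.1.diag_nonneg
  have diag_le_one (k : n) : ρ k k ≤ 1 :=
    hρ.2 ▸ Finset.single_le_sum (fun l _ ↦ diag_nonneg l) (Finset.mem_univ k)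
  have minor_nonneg : 0 ≤ ρ i i * ρ j j - ρ i j * ρ j i :=
    (hρ.1.submatrix ![i, j]).det_nonneg.trans_eq (det_fin_two _)
  have normSq_le : ((‖ρ i j‖ ^ 2 : ℝ) : ℂ) ≤ 1 := by
    rw [Complex.ofReal_pow, ← Complex.mul_conj', ← Complex.star_def, hρ.1.1.apply]
    exact (sub_nonneg.1 minor_nonneg).trans
      (mul_le_one₀ (diag_le_one i) (diag_nonneg j) (diag_le_one j))
  exact (sq_le_one_iff₀ (norm_nonneg _)).1 (by exact_mod_cast normSq_le)

variable {n L : Type} [Fintype n] [MeasurableSpace L] {π : Measure L} {f : L → ℝ}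
  {τ : L → Matrix n n ℂ}

theorem integrable_mul_apply (hf : Integrable f π) (hτm : ∀ i j, Measurable fun l ↦ τ l i j)
    (hτ : ∀ l, IsDensityMatrix (τ l)) (i j : n) :
    Integrable (fun l ↦ (f l : ℂ) * τ l i j) π :=
  hf.ofReal.mul_bdd (hτm i j).aestronglyMeasurable (.of_forall fun l ↦ (hτ l).norm_apply_le_one i j)

theorem integrable_mul_trace (hf : Integrable f π) (hτm : ∀ i j, Measurable fun l ↦ τ l i j)
    (hτ : ∀ l, IsDensityMatrix (τ l)) (N : Matrix n n ℂ) :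
    Integrable (fun l ↦ (f l : ℂ) * (τ l * N).trace) π := by
  simp only [trace, diag_apply, mul_apply, Finset.mul_sum, ← mul_assoc]
  exact integrable_finsetSum _ fun i _ ↦ integrable_finsetSum _ fun j _ ↦
    (integrable_mul_apply hf hτm hτ i j).mul_const _

theorem trace_mul_eq_integral {S : Matrix n n ℂ} (hf : Integrable f π)
    (hτm : ∀ i j, Measurable fun l ↦ τ l i j) (hτ : ∀ l, IsDensityMatrix (τ l))
    (hS : ∀ i j, S i j = ∫ l, (f l : ℂ) * τ l i j ∂π) (N : Matrix n n ℂ) :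
    (S * N).trace = ∫ l, (f l : ℂ) * (τ l * N).trace ∂π := by
  have integrable_term (i j : n) := (integrable_mul_apply hf hτm hτ i j).mul_const (N j i)
  simp only [trace, diag_apply, mul_apply, Finset.mul_sum, ← mul_assoc]
  rw [integral_finsetSum _ fun i _ ↦ integrable_finsetSum _ fun j _ ↦ integrable_term i j]
  simp only [integral_finsetSum _ fun j _ ↦ integrable_term _ j, integral_mul_const, hS]

theorem integrable_mul_trace_re (hf : Integrable f π) (hτm : ∀ i j, Measurable fun l ↦ τ l i j)
    (hτ : ∀ l, IsDensityMatrix (τ l)) (N : Matrix n n ℂ) :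
    Integrable (fun l ↦ f l * (τ l * N).trace.re) π := by
  simpa using (integrable_mul_trace hf hτm hτ N).re

theorem re_trace_mul_eq_integral {S : Matrix n n ℂ} (hf : Integrable f π)
    (hτm : ∀ i j, Measurable fun l ↦ τ l i j) (hτ : ∀ l, IsDensityMatrix (τ l))
    (hS : ∀ i j, S i j = ∫ l, (f l : ℂ) * τ l i j ∂π) (N : Matrix n n ℂ) :
    (S * N).trace.re = ∫ l, f l * (τ l * N).trace.re ∂π := by
  rw [trace_mul_eq_integral hf hτm hτ hS]
  simpa using (integral_re (integrable_mul_trace hf hτm hτ N)).symm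

theorem mulVec_eq_zero_ae_of_trace_eq_zero {S : Matrix n n ℂ} (hf : Integrable f π)
    (hf0 : ∀ l, 0 ≤ f l) (hτm : ∀ i j, Measurable fun l ↦ τ l i j)
    (hτ : ∀ l, IsDensityMatrix (τ l)) (hS : ∀ i j, S i j = ∫ l, (f l : ℂ) * τ l i j ∂π)
    {v : n → ℂ} (hv : (S * vecMulVec v (star v)).trace = 0) :
    ∀ᵐ l ∂π, f l ≠ 0 → τ l *ᵥ v = 0 := by
  have trace_nonneg (l : L) : 0 ≤ (τ l * vecMulVec v (star v)).trace :=
    trace_mul_nonneg_of_posSemidef (hτ l).1 (posSemidef_vecMulVec_self_star v)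
  have mul_trace_eq_zero :
      ∀ᵐ l ∂π, f l * (τ l * vecMulVec v (star v)).trace.re = 0 := by
    refine (integral_eq_zero_iff_of_nonneg
      (fun l ↦ mul_nonneg (hf0 l) (Complex.nonneg_iff.1 (trace_nonneg l)).1)
      (integrable_mul_trace_re hf hτm hτ _)).1 ?_
    rw [← re_trace_mul_eq_integral hf hτm hτ hS, hv, Complex.zero_re]
  filter_upwards [mul_trace_eq_zero] with l hl hfl
  rw [← (hτ l).1.dotProduct_mulVec_zero_iff, ← trace_mul_vecMulVec_star]
  exact Complex.ext ((mul_eq_zero.1 hl).resolve_left hfl)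
    (Complex.nonneg_iff.1 (trace_nonneg l)).2.symm

end LocalHiddenStates

section SteeringCriterion

theorem sum_mul_le_of_pairwise {ι : Type*} [Fintype ι] {p : ι → ℝ} {t : ℝ}
    (hp : ∀ k, p k ≤ 1) (ht : 0 ≤ t) (h : Pairwise fun j k ↦ p j ≠ 0 → p k ≠ 0 → t = 0) :
    ∑ k, p k * t ≤ t := by
  rcases ht.eq_or_lt with rfl | pos
  · simp
  by_cases all_zero : ∀ k, p k = 0
  · simpa [all_zero] using ht
  obtain ⟨k, hk⟩ := not_forall.1 all_zero
  have others_zero (j : ι) (hj : j ≠ k) : p j = 0 :=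
    by_contra fun hne ↦ pos.ne' (h hj hne hk)
  rw [Fintype.sum_eq_single k fun j hj ↦ by rw [others_zero j hj, zero_mul]]
  exact mul_le_of_le_one_left ht (hp k)

theorem mul_eq_zero_of_range_le_span_pair {n : Type*} [Fintype n] {T P : Matrix n n ℂ}
    {u v : n → ℂ} (hP : ∀ w, P *ᵥ w ∈ Submodule.span ℂ {u, v}) (hu : T *ᵥ u = 0)
    (hv : T *ᵥ v = 0) : T * P = 0 := by
  classical
  refine ext_of_mulVec_single fun i ↦ ?_
  obtain ⟨a, b, hab⟩ := Submodule.mem_span_pair.1 (hP (Pi.single i 1))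
  rw [← mulVec_mulVec, ← hab, mulVec_add, mulVec_smul, mulVec_smul, hu, hv,
    smul_zero, smul_zero, add_zero, zero_mulVec]

theorem HasLHSDecomposition.sum_trace_le {X n : Type} [Fintype X] [Fintype n] {A : X → Type}
    [∀ x, Fintype (A x)] {σ : ∀ x, A x → Matrix n n ℂ} (hσ : HasLHSDecomposition σ)
    (a : ∀ x, A x) {v : X → n → ℂ}
    (hv : ∀ x, (σ x (a x) * vecMulVec (v x) (star (v x))).trace = 0)
    {P : Matrix n n ℂ} (hP : P.PosSemidef)
    (hPv : Pairwise fun x y ↦ ∀ w, P *ᵥ w ∈ Submodule.span ℂ {v x, v y}) (x₀ : X) :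
    ∑ x, (σ x (a x) * P).trace.re ≤ ∑ b, (σ x₀ b * P).trace.re := by
  obtain ⟨L, _, π, _, p, τ, hp, hτm, hτ, hστ⟩ := hσ
  have annihilates : ∀ᵐ l ∂π, ∀ x, p x (a x) l ≠ 0 → τ l *ᵥ v x = 0 :=
    ae_all_iff.2 fun x ↦ mulVec_eq_zero_ae_of_trace_eq_zero (hp.integrable π x (a x))
      (hp.nonneg x (a x)) hτm hτ (hστ x (a x)) (hv x)
  have pointwise_le : ∀ᵐ l ∂π,
      ∑ x, p x (a x) l * (τ l * P).trace.re ≤ ∑ b, p x₀ b l * (τ l * P).trace.re := by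
    filter_upwards [annihilates] with l hl
    rw [← Finset.sum_mul Finset.univ (fun b ↦ p x₀ b l), hp.sum_eq_one, one_mul]
    refine sum_mul_le_of_pairwise (fun x ↦ hp.le_one x (a x) l)
      (Complex.nonneg_iff.1 (trace_mul_nonneg_of_posSemidef (hτ l).1 hP)).1 fun x y hxy hx hy ↦ ?_
    rw [mul_eq_zero_of_range_le_span_pair (hPv hxy) (hl x hx) (hl y hy), trace_zero,
      Complex.zero_re]
  have integrable_term (x : X) (b : A x) := integrable_mul_trace_re (hp.integrable π x b) hτm hτ P
  simp only [fun x b ↦ re_trace_mul_eq_integral (hp.integrable π x b) hτm hτ (hστ x b) P]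
  rw [← integral_finsetSum _ fun x _ ↦ integrable_term x (a x),
    ← integral_finsetSum _ fun b _ ↦ integrable_term x₀ b]
  exact integral_mono_ae (integrable_finsetSum _ fun x _ ↦ integrable_term x (a x))
    (integrable_finsetSum _ fun b _ ↦ integrable_term x₀ b) pointwise_le

theorem posSemidef_one_sub_vecMulVec_star {n : Type*} [Fintype n] [DecidableEq n] {u : n → ℂ}
    (hu : star u ⬝ᵥ u = 1) : (1 - vecMulVec u (star u)).PosSemidef := by
  have isHermitian : (1 - vecMulVec u (star u))ᴴ = 1 - vecMulVec u (star u) :=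
    isHermitian_one.sub (posSemidef_vecMulVec_self_star u).1
  have idempotent : (1 - vecMulVec u (star u)) * (1 - vecMulVec u (star u)) =
      1 - vecMulVec u (star u) := by
    simp [sub_mul, mul_sub, vecMulVec_mul_vecMulVec, hu]
  have h := posSemidef_conjTranspose_mul_self (1 - vecMulVec u (star u))
  rwa [isHermitian, idempotent] at h

/-- The dichotomic measurement `{|u⟩⟨u|, 𝕀 - |u⟩⟨u|}` of a unit vector `u`; the outcome `true`
stands for `|u⟩⟨u|`. -/
def POVM.ofUnitVector {n : Type} [Fintype n] [DecidableEq n] (u : n → ℂ)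
    (hu : star u ⬝ᵥ u = 1) : POVM Bool n where
  effect a := if a then vecMulVec u (star u) else 1 - vecMulVec u (star u)
  posSemidef
    | true => posSemidef_vecMulVec_self_star u
    | false => posSemidef_one_sub_vecMulVec_star hu
  sum_eq_one := by simp

variable {m n : Type} [Fintype m] [DecidableEq m] [Fintype n] [DecidableEq n]

theorem isSteerableAliceToBob_of_trace_lt {ρ : Matrix (m × n) (m × n) ℂ} {K : Type} [Fintype K]
    [Nonempty K] {u : K → m → ℂ} (hu : ∀ k, star (u k) ⬝ᵥ u k = 1) {v : K → n → ℂ}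
    (huv : ∀ k, (ρ * (vecMulVec (u k) (star (u k)) ⊗ₖ vecMulVec (v k) (star (v k)))).trace = 0)
    {P : Matrix n n ℂ} (hP : P.PosSemidef)
    (hPv : Pairwise fun j k ↦ ∀ w, P *ᵥ w ∈ Submodule.span ℂ {v j, v k})
    (hlt : (ρ * (1 ⊗ₖ P)).trace.re
      < ∑ k, (ρ * (vecMulVec (u k) (star (u k)) ⊗ₖ P)).trace.re) :
    IsSteerableAliceToBob ρ := by
  refine ⟨K, inferInstance, fun _ ↦ Bool, fun _ ↦ inferInstance,
    fun k ↦ .ofUnitVector (u k) (hu k), fun hσ ↦ hlt.not_ge ?_⟩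
  have h := hσ.sum_trace_le (fun _ ↦ true) (v := v)
    (fun k ↦ (trace_trFst_kronecker_mul _ _ _).trans (huv k)) hP hPv (Classical.arbitrary K)
  simpa [POVM.ofUnitVector, trace_trFst_kronecker_mul, ← Complex.add_re, ← trace_add, ← mul_add,
    ← add_kronecker] using h

theorem isSteerableBobToAlice_of_trace_lt {ρ : Matrix (m × n) (m × n) ℂ} {K : Type} [Fintype K]
    [Nonempty K] {v : K → n → ℂ} (hv : ∀ k, star (v k) ⬝ᵥ v k = 1) {u : K → m → ℂ}
    (huv : ∀ k, (ρ * (vecMulVec (u k) (star (u k)) ⊗ₖ vecMulVec (v k) (star (v k)))).trace = 0)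
    {P : Matrix m m ℂ} (hP : P.PosSemidef)
    (hPu : Pairwise fun j k ↦ ∀ w, P *ᵥ w ∈ Submodule.span ℂ {u j, u k})
    (hlt : (ρ * (P ⊗ₖ 1)).trace.re
      < ∑ k, (ρ * (P ⊗ₖ vecMulVec (v k) (star (v k)))).trace.re) :
    IsSteerableBobToAlice ρ := by
  refine ⟨K, inferInstance, fun _ ↦ Bool, fun _ ↦ inferInstance,
    fun k ↦ .ofUnitVector (v k) (hv k), fun hσ ↦ hlt.not_ge ?_⟩
  have h := hσ.sum_trace_le (fun _ ↦ true) (v := u)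
    (fun k ↦ (trace_trSnd_kronecker_mul _ _ _).trans (huv k)) hP hPu (Classical.arbitrary K)
  simpa [POVM.ofUnitVector, trace_trSnd_kronecker_mul, ← Complex.add_re, ← trace_add, ← mul_add,
    ← kronecker_add] using h

end SteeringCriterion

section Steering

/-- The qubit vector `cos θ |0⟩ + sin θ |1⟩`. -/
def realQubit (θ : ℝ) : Fin 3 → ℂ := ![Real.cos θ, Real.sin θ, 0]

theorem star_realQubit_dotProduct_self (θ : ℝ) : star (realQubit θ) ⬝ᵥ realQubit θ = 1 := by
  simp only [dotProduct, Fin.sum_univ_three, realQubit, Pi.star_apply, cons_val_zero, cons_val_one,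
    cons_val, Complex.star_def, Complex.conj_ofReal, mul_zero, add_zero, ← sq]
  exact_mod_cast Real.cos_sq_add_sin_sq θ

theorem qubitId_mulVec_mem_span_realQubit {θ φ : ℝ} (h : Real.sin (φ - θ) ≠ 0) (w : Fin 3 → ℂ) :
    qubitId *ᵥ w ∈ Submodule.span ℂ {realQubit θ, realQubit φ} := by
  have det_ne_zero : (Real.sin φ * Real.cos θ - Real.cos φ * Real.sin θ : ℂ) ≠ 0 := by
    rw [Real.sin_sub] at h
    exact_mod_cast h
  rw [Submodule.mem_span_pair]
  -- Cramer's rule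
  refine ⟨(w 0 * Real.sin φ - w 1 * Real.cos φ) /
      (Real.sin φ * Real.cos θ - Real.cos φ * Real.sin θ),
    (w 1 * Real.cos θ - w 0 * Real.sin θ) /
      (Real.sin φ * Real.cos θ - Real.cos φ * Real.sin θ), ?_⟩
  ext i
  fin_cases i <;>
    simp [qubitId, ketbra, realQubit, mulVec, dotProduct, single_apply, -Complex.ofReal_cos,
      -Complex.ofReal_sin] <;>
    field_simp <;>
    ring

theorem vecMulVec_realQubit_star (θ : ℝ) :
    vecMulVec (realQubit θ) (star (realQubit θ)) =
      !![(Real.cos θ ^ 2 : ℂ), Real.cos θ * Real.sin θ, 0;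
        Real.cos θ * Real.sin θ, Real.sin θ ^ 2, 0;
        0, 0, 0] := by
  ext i j
  rw [vecMulVec_apply, Pi.star_apply]
  fin_cases i <;> fin_cases j <;>
    simp [realQubit, Complex.conj_ofReal, sq, mul_comm, -Complex.ofReal_cos, -Complex.ofReal_sin]

theorem trace_rhoG_mul_realQubit_kronecker_self (q θ : ℝ) :
    (rhoG q * (vecMulVec (realQubit θ) (star (realQubit θ)) ⊗ₖ
      vecMulVec (realQubit θ) (star (realQubit θ)))).trace = 0 := by
  rw [trace_rhoG_mul_kronecker, vecMulVec_realQubit_star]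
  simp [-mul_eq_zero, -div_eq_zero_iff]
  ring

theorem trace_rhoG_mul_realQubit_kronecker_qubitId (q θ : ℝ) :
    (rhoG q * (vecMulVec (realQubit θ) (star (realQubit θ)) ⊗ₖ qubitId)).trace =
      ((q / 18 : ℝ) : ℂ) := by
  rw [trace_rhoG_mul_kronecker, vecMulVec_realQubit_star]
  simp [qubitId, ketbra]
  ring

theorem trace_rhoG_mul_qubitId_kronecker_realQubit (q θ : ℝ) :
    (rhoG q * (qubitId ⊗ₖ vecMulVec (realQubit θ) (star (realQubit θ)))).trace =
      ((q / 18 : ℝ) : ℂ) := by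
  rw [trace_rhoG_mul_kronecker, vecMulVec_realQubit_star]
  simp [qubitId, ketbra]
  ring

theorem trace_rhoG_mul_one_kronecker_qubitId (q : ℝ) :
    (rhoG q * (1 ⊗ₖ qubitId)).trace = ((q / 3 : ℝ) : ℂ) := by
  rw [trace_rhoG_mul_kronecker]
  simp [qubitId, ketbra]
  ring

theorem trace_rhoG_mul_qubitId_kronecker_one (q : ℝ) :
    (rhoG q * (qubitId ⊗ₖ 1)).trace = ((1 / 3 : ℝ) : ℂ) := by
  rw [trace_rhoG_mul_kronecker]
  simp [qubitId, ketbra]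
  ring

theorem sin_natCast_div_sub_ne_zero {K : ℕ} {j k : Fin K} (h : j ≠ k) :
    Real.sin (k / K - j / K) ≠ 0 := by
  have K_pos : (0 : ℝ) < K := by exact_mod_cast j.pos
  have mem_Ico (i : Fin K) : 0 ≤ (i / K : ℝ) ∧ (i / K : ℝ) < 1 :=
    ⟨by positivity, (div_lt_one K_pos).2 (by exact_mod_cast i.2)⟩
  obtain ⟨j_nonneg, j_lt_one⟩ := mem_Ico j
  obtain ⟨k_nonneg, k_lt_one⟩ := mem_Ico k
  rw [Ne, Real.sin_eq_zero_iff_of_lt_of_lt (by linarith [Real.pi_gt_three])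
    (by linarith [Real.pi_gt_three]), sub_eq_zero, div_left_inj' K_pos.ne', Nat.cast_inj]
  exact fun hkj ↦ h (Fin.ext hkj.symm)

theorem isSteerableAliceToBob_rhoG {q : ℝ} (hq : 0 < q) : IsSteerableAliceToBob (rhoG q) := by
  refine isSteerableAliceToBob_of_trace_lt (K := Fin 7) (fun _ ↦ star_realQubit_dotProduct_self _)
    (fun k ↦ trace_rhoG_mul_realQubit_kronecker_self q (k / (7 : ℕ))) posSemidef_qubitId
    (fun j k hjk ↦ qubitId_mulVec_mem_span_realQubit (sin_natCast_div_sub_ne_zero hjk)) ?_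
  simp only [trace_rhoG_mul_realQubit_kronecker_qubitId, trace_rhoG_mul_one_kronecker_qubitId,
    Complex.ofReal_re, Finset.sum_const, Finset.card_univ, Fintype.card_fin, nsmul_eq_mul]
  push_cast
  linarith

theorem isSteerableBobToAlice_rhoG {q : ℝ} (hq : 0 < q) : IsSteerableBobToAlice (rhoG q) := by
  obtain ⟨K, hK⟩ := exists_nat_gt (6 / q)
  have : NeZero K := ⟨fun h ↦ by
    rw [h, Nat.cast_zero] at hK
    exact hK.not_gt (by positivity)⟩
  refine isSteerableBobToAlice_of_trace_lt (K := Fin K) (fun _ ↦ star_realQubit_dotProduct_self _)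
    (fun k ↦ trace_rhoG_mul_realQubit_kronecker_self q (k / K)) posSemidef_qubitId
    (fun j k hjk ↦ qubitId_mulVec_mem_span_realQubit (sin_natCast_div_sub_ne_zero hjk)) ?_
  simp only [trace_rhoG_mul_qubitId_kronecker_realQubit, trace_rhoG_mul_qubitId_kronecker_one,
    Complex.ofReal_re, Finset.sum_const, Finset.card_univ, Fintype.card_fin, nsmul_eq_mul]
  rw [div_lt_iff₀ hq] at hK
  linarith

end Steering

end QSteering

end

theorem mainTheorem3_general (q : ℝ) (hq : 0 < q) (hq3 : q ≤ 3) :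
    QSteering.IsDensityMatrix (QSteering.rhoG q) ∧
      QSteering.IsSteerableAliceToBob (QSteering.rhoG q) ∧
      QSteering.IsSteerableBobToAlice (QSteering.rhoG q) ∧
      (q ≤ 1 / 2 → QSteering.IsLocalForPOVMs (QSteering.rhoG q)) :=
  ⟨QSteering.isDensityMatrix_rhoG hq.le hq3, QSteering.isSteerableAliceToBob_rhoG hq,
    QSteering.isSteerableBobToAlice_rhoG hq, QSteering.isLocalForPOVMs_rhoG hq.le⟩

theorem mainTheorem3 (q : ℝ) (hq : 0 < q) (hq1 : q ≤ 1) :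
    QSteering.IsDensityMatrix (QSteering.rhoG q) ∧
      QSteering.IsSteerableAliceToBob (QSteering.rhoG q) ∧
      QSteering.IsSteerableBobToAlice (QSteering.rhoG q) ∧
      (q ≤ 1 / 2 → QSteering.IsLocalForPOVMs (QSteering.rhoG q)) :=
  mainTheorem3_general q hq (hq1.trans (by norm_num))
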